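/- Let $d\in\{1,2,3\}$, let $\Omega\subset\mathbb{R}^d$ be a bounded open set (in particular, any bounded smooth domain), and let $\kappa>0$, $\alpha\in(0,1)$, $T>0$, $N\in\mathbb{N}$ with $N\ge1$, and $\tau=T/N$. Put $F(s)=\frac14(1-s^2)^2$ and $$E(u)=\int_\Omega \frac{\kappa^2}{2}|\nabla u|^2+F(u)\,dx .$$ Let $\omega_j=(-1)^j\frac{\alpha(\alpha-1)\cdots(\alpha-j+1)}{j!}$ for $j\ge0$ (so $\omega_0=1$). For a sequence of functions $u_0,u_1,\dots$ on $\Omega$ and $n\ge1$ define the backward Euler convolution quadrature and the fractional extrapolation by $$\bar\partial_\tau^\alpha u_n=\tau^{-\alpha}\sum_{j=1}^n\omega_{n-j}(u_j-u_0),\qquad u_{n,\alpha}=\omega_0u_0-\sum_{j=1}^{n-1}\omega_{n-j}(u_j-u_0),$$ so that $u_n-u_{n,\alpha}=\tau^\alpha\bar\partial_\tau^\alpha u_n$. Then $u_{n,\alpha}$ is a convex combination of $u_0,\dots,u_{n-1}$ for every $n\ge1$, and the following hold. (i) (WCS scheme) If $u_0,\dots,u_N\in H_0^1(\Omega)$ satisfy,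 for $1\le n\le N$, $$\bar\partial_\tau^\alpha u_n-\kappa^2\Delta u_n=u_{n,\alpha}-(u_n)^3$$ weakly, i.e. tested against every $v\in H_0^1(\Omega)$, then $E(u_n)$ and $E(u_{n,\alpha})$ are finite and $E(u_n)\le E(u_{n,\alpha})$ for all $1\le n\le N$, without any restriction on $\tau$. (ii) (LWS scheme) Let $S>0$ with $S+\tau^{-\alpha}\ge2$. If $u_0,\dots,u_N\in H_0^1(\Omega)$ satisfy, for $1\le n\le N$, $$\bar\partial_\tau^\alpha u_n-\kappa^2\Delta u_n=u_{n,\alpha}-(u_{n,\alpha})^3-S(u_n-u_{n,\alpha})$$ weakly in the same sense, and if $|u_0|\le1$ a.e. in $\Omega$, then $E(u_n)$ and $E(u_{n,\alpha})$ are finite and $E(u_n)\le E(u_{n,\alpha})$ for all $1\le n\le N$. -/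

import Mathlib

open MeasureTheory Filter Topology
open scoped Gradient ContDiff

namespace FracAllenCahn

noncomputable section

/-- `φ` is a test function on `Ω`, that is `φ ∈ C_c^∞(Ω)`. -/
structure IsTestFunction {d : ℕ} (Ω : Set (EuclideanSpace ℝ (Fin d)))
    (φ : EuclideanSpace ℝ (Fin d) → ℝ) : Prop where
  smooth : ContDiff ℝ ∞ φ
  compact : HasCompactSupport φ
  supp : tsupport φ ⊆ Ω

/-- `g` is a weak (distributional) gradient of `u` on `Ω`. -/
structure IsWeakGradient {d : ℕ} (Ω : Set (EuclideanSpace ℝ (Fin d)))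
    (u : EuclideanSpace ℝ (Fin d) → ℝ)
    (g : EuclideanSpace ℝ (Fin d) → EuclideanSpace ℝ (Fin d)) : Prop where
  locInt : LocallyIntegrableOn u Ω
  locInt_grad : LocallyIntegrableOn g Ω
  byParts : ∀ φ : EuclideanSpace ℝ (Fin d) → ℝ, IsTestFunction Ω φ →
    ∫ x in Ω, u x • ∇ φ x = - ∫ x in Ω, φ x • g x

/-- A weak gradient on an open set is unique up to equality almost everywhere. -/
theorem IsWeakGradient.ae_eq {d : ℕ} {Ω : Set (EuclideanSpace ℝ (Fin d))} (hΩ : IsOpen Ω)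
    {u : EuclideanSpace ℝ (Fin d) → ℝ}
    {g₁ g₂ : EuclideanSpace ℝ (Fin d) → EuclideanSpace ℝ (Fin d)}
    (h₁ : IsWeakGradient Ω u g₁) (h₂ : IsWeakGradient Ω u g₂) :
    g₁ =ᵐ[volume.restrict Ω] g₂ := by
  have key : ∀ᵐ x, x ∈ Ω → (g₁ - g₂) x = 0 := by
    refine hΩ.ae_eq_zero_of_integral_contDiff_smul_eq_zero
      (h₁.locInt_grad.sub h₂.locInt_grad) ?_
    intro φ hφ hc hs
    have hint : ∀ g : EuclideanSpace ℝ (Fin d) → EuclideanSpace ℝ (Fin d),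
        LocallyIntegrableOn g Ω → IntegrableOn (fun x => φ x • g x) Ω := by
      intro g hg
      have hK : IntegrableOn (fun x => φ x • g x) (tsupport φ) :=
        (hg.integrableOn_compact_subset hs hc).continuousOn_smul hφ.continuous.continuousOn
          hc
      refine IntegrableOn.of_forall_sdiff_eq_zero hK hΩ.measurableSet ?_
      intro x hx
      simp [image_eq_zero_of_notMem_tsupport hx.2]
    have e := (h₁.byParts φ ⟨hφ, hc, hs⟩).symm.trans (h₂.byParts φ ⟨hφ, hc, hs⟩)
    have hset : ∫ x, φ x • (g₁ - g₂) x = ∫ x in Ω, φ x • (g₁ - g₂) x := by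
      refine (setIntegral_eq_integral_of_forall_compl_eq_zero ?_).symm
      intro x hx
      simp [image_eq_zero_of_notMem_tsupport (fun h => hx (hs h))]
    rw [hset]
    simp only [Pi.sub_apply, smul_sub]
    rw [integral_sub (hint _ h₁.locInt_grad) (hint _ h₂.locInt_grad), neg_injective e, sub_self]
  rw [Filter.EventuallyEq, ae_restrict_iff' hΩ.measurableSet]
  filter_upwards [key] with x hx hxΩ
  exact sub_eq_zero.mp (hx hxΩ)

open Classical in
/-- The weak gradient `∇u` of `u` on `Ω` (zero if there is none). -/
def weakGrad {d : ℕ} (Ω : Set (EuclideanSpace ℝ (Fin d)))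
    (u : EuclideanSpace ℝ (Fin d) → ℝ) :
    EuclideanSpace ℝ (Fin d) → EuclideanSpace ℝ (Fin d) :=
  if h : ∃ g, IsWeakGradient Ω u g then h.choose else 0

/-- `u ∈ H¹(Ω)`: both `u` and its weak gradient exist in `L²(Ω)`. -/
structure MemH1 {d : ℕ} (Ω : Set (EuclideanSpace ℝ (Fin d)))
    (u : EuclideanSpace ℝ (Fin d) → ℝ) : Prop where
  memLp : MemLp u 2 (volume.restrict Ω)
  isWeakGradient : IsWeakGradient Ω u (weakGrad Ω u)
  memLp_grad : MemLp (weakGrad Ω u) 2 (volume.restrict Ω)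

/-- `u ∈ H¹₀(Ω)`: `u` is the limit, in the norm of `H¹(Ω)`, of test functions on `Ω`. -/
structure MemH10 {d : ℕ} (Ω : Set (EuclideanSpace ℝ (Fin d)))
    (u : EuclideanSpace ℝ (Fin d) → ℝ) : Prop extends MemH1 Ω u where
  approx : ∃ φ : ℕ → EuclideanSpace ℝ (Fin d) → ℝ, (∀ k, IsTestFunction Ω (φ k)) ∧
    Tendsto (fun k => eLpNorm (φ k - u) 2 (volume.restrict Ω)) atTop (𝓝 0) ∧
    Tendsto (fun k => eLpNorm (∇ (φ k) - weakGrad Ω u) 2 (volume.restrict Ω)) atTop (𝓝 0)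

/-- The double-well potential `F(s) = (1 - s²)² / 4`. -/
def potential (s : ℝ) : ℝ := (1 / 4) * (1 - s ^ 2) ^ 2

/-- The energy density `κ²/2 |∇u|² + F(u)`. -/
def energyDensity {d : ℕ} (Ω : Set (EuclideanSpace ℝ (Fin d))) (κ : ℝ)
    (u : EuclideanSpace ℝ (Fin d) → ℝ) (x : EuclideanSpace ℝ (Fin d)) : ℝ :=
  κ ^ 2 / 2 * ‖weakGrad Ω u x‖ ^ 2 + potential (u x)

/-- The energy `E(u) = ∫_Ω κ²/2 |∇u|² + F(u) dx`. -/
def energy {d : ℕ} (Ω : Set (EuclideanSpace ℝ (Fin d))) (κ : ℝ)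
    (u : EuclideanSpace ℝ (Fin d) → ℝ) : ℝ :=
  ∫ x in Ω, energyDensity Ω κ u x

/-- The backward Euler convolution quadrature weights
`ω_j = (-1)^j α (α - 1) ⋯ (α - j + 1) / j!`. -/
def omega (α : ℝ) (j : ℕ) : ℝ :=
  (-1) ^ j * (∏ i ∈ Finset.range j, (α - (i : ℝ))) / (j.factorial : ℝ)

/-- The discrete fractional derivative
`τ^{-α} ∑_{j=1}^n ω_{n-j} (u_j - u_0)` of the sequence `u` at step `n`. -/
def fracDiff {d : ℕ} (α τ : ℝ) (u : ℕ → EuclideanSpace ℝ (Fin d) → ℝ) (n : ℕ) :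
    EuclideanSpace ℝ (Fin d) → ℝ :=
  τ ^ (-α) • ∑ j ∈ Finset.Icc 1 n, omega α (n - j) • (u j - u 0)

/-- The fractional extrapolation
`u_{n,α} = ω_0 u_0 - ∑_{j=1}^{n-1} ω_{n-j} (u_j - u_0)`. -/
def fracExtrap {d : ℕ} (α : ℝ) (u : ℕ → EuclideanSpace ℝ (Fin d) → ℝ) (n : ℕ) :
    EuclideanSpace ℝ (Fin d) → ℝ :=
  omega α 0 • u 0 - ∑ j ∈ Finset.Ico 1 n, omega α (n - j) • (u j - u 0)

/-- `w ∈ H¹₀(Ω)` satisfies weakly `D - κ² Δ w = f` with homogeneous Dirichlet boundary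
condition; `D` is a given function (the discrete time derivative). -/
def WeakEquation {d : ℕ} (Ω : Set (EuclideanSpace ℝ (Fin d))) (κ : ℝ)
    (D w f : EuclideanSpace ℝ (Fin d) → ℝ) : Prop :=
  ∀ v : EuclideanSpace ℝ (Fin d) → ℝ, MemH10 Ω v →
    (∫ x in Ω, D x * v x) + κ ^ 2 * (∫ x in Ω, inner ℝ (weakGrad Ω w x) (weakGrad Ω v x))
      = ∫ x in Ω, f x * v x

/-- `u_0, …, u_N ∈ H¹₀(Ω)` solves the weighted convex splitting scheme
`∂_τ^α u_n - κ² Δ u_n = u_{n,α} - u_n³`, `1 ≤ n ≤ N`. -/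
structure IsWCSSolution {d : ℕ} (Ω : Set (EuclideanSpace ℝ (Fin d))) (κ α τ : ℝ) (N : ℕ)
    (u : ℕ → EuclideanSpace ℝ (Fin d) → ℝ) : Prop where
  mem : ∀ n ≤ N, MemH10 Ω (u n)
  eqn : ∀ n, 1 ≤ n → n ≤ N →
    WeakEquation Ω κ (fracDiff α τ u n) (u n)
      (fun x => fracExtrap α u n x - (u n x) ^ 3)

/-- `u_0, …, u_N ∈ H¹₀(Ω)` solves the linear weighted stabilized scheme
`∂_τ^α u_n - κ² Δ u_n = u_{n,α} - u_{n,α}³ - S (u_n - u_{n,α})`, `1 ≤ n ≤ N`. -/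
structure IsLWSSolution {d : ℕ} (Ω : Set (EuclideanSpace ℝ (Fin d))) (κ α τ S : ℝ) (N : ℕ)
    (u : ℕ → EuclideanSpace ℝ (Fin d) → ℝ) : Prop where
  mem : ∀ n ≤ N, MemH10 Ω (u n)
  eqn : ∀ n, 1 ≤ n → n ≤ N →
    WeakEquation Ω κ (fracDiff α τ u n) (u n)
      (fun x => fracExtrap α u n x - (fracExtrap α u n x) ^ 3
        - S * (u n x - fracExtrap α u n x))

/-- `E(w) ≤ E(v)`, both energies being finite. -/
structure EnergyLE {d : ℕ} (Ω : Set (EuclideanSpace ℝ (Fin d))) (κ : ℝ)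
    (w v : EuclideanSpace ℝ (Fin d) → ℝ) : Prop where
  finite_left : IntegrableOn (energyDensity Ω κ w) Ω
  finite_right : IntegrableOn (energyDensity Ω κ v) Ω
  le : energy Ω κ w ≤ energy Ω κ v

end

end FracAllenCahn

open FracAllenCahn

/-! The weights satisfy ω_j ≤ 0 for j ≥ 1 and have nonnegative partial sums, so `fracExtrap` is a
convex combination of the earlier iterates, and the discrete derivative is τ^{-α}(w - b) with w =
u_n, b = u_{n,α}. One step is thus a gradient-flow step from b to w. Testing it with w - b and
writing κ²/2(|∇w|² - |∇b|²) = κ²∇w·∇(w - b) - κ²/2|∇(w - b)|² reduces energy decay to a pointwise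
inequality for F (`energyLE_of_weakEquation`).

For WCS that inequality is convex splitting: s⁴/4 is implicit, -s²/2 explicit. The cubic term is
integrable against w - b because H¹₀ ⊂ L⁴ for d ≤ 3 (`IsH10Limit.memLp_four`).

For LWS the stabilization must absorb the Taylor remainder of F, which is controlled only on [-1,
1]. A maximum principle (`abs_le_one_lws`) keeps the iterates there: the equation is tested with a
smooth monotone function of w vanishing on [-1, 1], admissible by the chain rule `IsH10Limit.comp`.
-/

namespace FracAllenCahn

variable {d : ℕ} {Ω : Set (EuclideanSpace ℝ (Fin d))}
  {φ ψ : EuclideanSpace ℝ (Fin d) → ℝ}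

/-! ### Calculus of test functions -/

namespace IsTestFunction

lemma differentiable (h : IsTestFunction Ω φ) : Differentiable ℝ φ :=
  h.smooth.differentiable (by simp)

lemma continuous_gradient (h : IsTestFunction Ω φ) : Continuous (∇ φ) :=
  (InnerProductSpace.toDual ℝ (EuclideanSpace ℝ (Fin d))).symm.continuous.comp
    (h.smooth.continuous_fderiv (by simp))

lemma hasCompactSupport_gradient (h : IsTestFunction Ω φ) : HasCompactSupport (∇ φ) :=
  (h.compact.fderiv (𝕜 := ℝ)).comp_left
    (g := (InnerProductSpace.toDual ℝ (EuclideanSpace ℝ (Fin d))).symm) (map_zero _)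

lemma eq_zero (h : IsTestFunction Ω φ) {x : EuclideanSpace ℝ (Fin d)} (hx : x ∉ Ω) : φ x = 0 :=
  image_eq_zero_of_notMem_tsupport fun h' => hx (h.supp h')

lemma gradient_eq_zero (h : IsTestFunction Ω φ) {x : EuclideanSpace ℝ (Fin d)} (hx : x ∉ Ω) :
    ∇ φ x = 0 := by
  have : fderiv ℝ φ x = 0 := by
    by_contra h'
    exact hx (h.supp (support_fderiv_subset ℝ h'))
  simp [gradient, this]

lemma memLp (h : IsTestFunction Ω φ) (p : ENNReal) : MemLp φ p (volume.restrict Ω) :=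
  (h.smooth.continuous.memLp_of_hasCompactSupport h.compact).restrict Ω

lemma memLp_gradient (h : IsTestFunction Ω φ) (p : ENNReal) :
    MemLp (∇ φ) p (volume.restrict Ω) :=
  (h.continuous_gradient.memLp_of_hasCompactSupport h.hasCompactSupport_gradient).restrict Ω

lemma add (hφ : IsTestFunction Ω φ) (hψ : IsTestFunction Ω ψ) : IsTestFunction Ω (φ + ψ) where
  smooth := hφ.smooth.add hψ.smooth
  compact := hφ.compact.add hψ.compact
  supp := (tsupport_add φ ψ).trans (Set.union_subset hφ.supp hψ.supp)

lemma gradient_add (hφ : IsTestFunction Ω φ) (hψ : IsTestFunction Ω ψ) :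
    ∇ (φ + ψ) = ∇ φ + ∇ ψ := by
  ext1 x
  simp [gradient, fderiv_add (hφ.differentiable x) (hψ.differentiable x)]

lemma comp (h : IsTestFunction Ω φ) {G : ℝ → ℝ} (hG : ContDiff ℝ ∞ G) (hG0 : G 0 = 0) :
    IsTestFunction Ω (G ∘ φ) where
  smooth := hG.comp h.smooth
  compact := h.compact.comp_left hG0
  supp := (closure_mono (Function.support_comp_subset hG0 φ)).trans h.supp

lemma gradient_comp (h : IsTestFunction Ω φ) {G : ℝ → ℝ} (hG : ContDiff ℝ ∞ G) :
    ∇ (G ∘ φ) = fun x => deriv G (φ x) • ∇ φ x := by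
  ext1 x
  have := ((hG.differentiable (by simp) (φ x)).hasDerivAt.comp_hasFDerivAt x
    (h.differentiable x).hasFDerivAt).fderiv
  simp only [gradient, this, map_smul]

/-- Both integrands vanish off Ω, so the integrals are over the whole space; pairing with a fixed
vector v leaves scalar integration by parts for the derivative along v. -/
lemma integral_smul_gradient (hφ : IsTestFunction Ω φ) (hψ : IsTestFunction Ω ψ) :
    ∫ x in Ω, φ x • ∇ ψ x = - ∫ x in Ω, ψ x • ∇ φ x := by
  rw [setIntegral_eq_integral_of_forall_compl_eq_zero
      (fun x hx => by simp [hφ.eq_zero hx]),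
    setIntegral_eq_integral_of_forall_compl_eq_zero (fun x hx => by simp [hψ.eq_zero hx])]
  have hint : ∀ {f g : EuclideanSpace ℝ (Fin d) → ℝ}, IsTestFunction Ω f → IsTestFunction Ω g →
      Integrable (fun x => f x • ∇ g x) := fun hf hg =>
    (hf.smooth.continuous.smul hg.continuous_gradient).integrable_of_hasCompactSupport
      hf.compact.smul_right
  refine ext_inner_left ℝ fun v => ?_
  rw [inner_neg_right, ← integral_inner (hint hφ hψ), ← integral_inner (hint hψ hφ)]
  have e : ∀ f g : EuclideanSpace ℝ (Fin d) → ℝ, ∀ x,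
      inner ℝ v (f x • ∇ g x) = f x * fderiv ℝ g x v := fun f g x => by
    rw [inner_smul_right, inner_gradient_right]; rfl
  have key := integral_mul_fderiv_eq_neg_fderiv_mul_of_integrable
    (μ := (volume : Measure (EuclideanSpace ℝ (Fin d)))) (f := φ) (g := ψ) (v := v)
    (by simpa only [e, mul_comm] using (hint hψ hφ).const_inner (𝕜 := ℝ) v)
    (by simpa only [e] using (hint hφ hψ).const_inner (𝕜 := ℝ) v)
    ((hφ.smooth.continuous.mul hψ.smooth.continuous).integrable_of_hasCompactSupport
      hφ.compact.mul_right)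
    (fun x _ => hφ.differentiable x) (fun x _ => hψ.differentiable x)
  simpa only [e, mul_comm] using key

end IsTestFunction

/-! ### Limits in L² -/

lemma tendsto_integral_smul_of_tendsto_eLpNorm {X F : Type*} [MeasurableSpace X] {μ : Measure X}
    [NormedAddCommGroup F] [NormedSpace ℝ F] {a : ℕ → X → ℝ} {b : ℕ → X → F} {a₀ : X → ℝ}
    {b₀ : X → F} (ha : ∀ k, MemLp (a k) 2 μ) (hb : ∀ k, MemLp (b k) 2 μ)
    (ha₀ : MemLp a₀ 2 μ) (hb₀ : MemLp b₀ 2 μ)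
    (hat : Tendsto (fun k => eLpNorm (a k - a₀) 2 μ) atTop (𝓝 0))
    (hbt : Tendsto (fun k => eLpNorm (b k - b₀) 2 μ) atTop (𝓝 0)) :
    Tendsto (fun k => ∫ x, a k x • b k x ∂μ) atTop (𝓝 (∫ x, a₀ x • b₀ x ∂μ)) := by
  have hint : ∀ {f : X → ℝ} {g : X → F}, MemLp f 2 μ → MemLp g 2 μ → Integrable (f • g) μ :=
    fun hf hg => memLp_one_iff_integrable.mp (hg.smul hf)
  refine tendsto_integral_of_L1' (fun x => a₀ x • b₀ x) (hint ha₀ hb₀).aestronglyMeasurable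
    (Eventually.of_forall fun k => hint (ha k) (hb k)) ?_
  have hbd : ∀ k, eLpNorm (fun x => a k x • b k x - a₀ x • b₀ x) 1 μ ≤
      (eLpNorm (a k - a₀) 2 μ * eLpNorm (b k - b₀) 2 μ + eLpNorm a₀ 2 μ * eLpNorm (b k - b₀) 2 μ)
        + eLpNorm (a k - a₀) 2 μ * eLpNorm b₀ 2 μ := by
    intro k
    have e : (fun x => a k x • b k x - a₀ x • b₀ x) =
        ((a k - a₀) • (b k - b₀) + a₀ • (b k - b₀)) + (a k - a₀) • b₀ := by
      ext x
      simp only [Pi.add_apply, Pi.smul_apply', Pi.sub_apply]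
      module
    have hA := (ha k).sub ha₀
    have hB := (hb k).sub hb₀
    rw [e]
    refine (eLpNorm_add_le ((hint hA hB).add (hint ha₀ hB)).aestronglyMeasurable
      (hint hA hb₀).aestronglyMeasurable le_rfl).trans (add_le_add ((eLpNorm_add_le
      (hint hA hB).aestronglyMeasurable (hint ha₀ hB).aestronglyMeasurable le_rfl).trans
      (add_le_add ?_ ?_)) ?_)
    · exact eLpNorm_smul_le_mul_eLpNorm hB.1 hA.1
    · exact eLpNorm_smul_le_mul_eLpNorm hB.1 ha₀.1
    · exact eLpNorm_smul_le_mul_eLpNorm hb₀.1 hA.1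
  refine tendsto_of_tendsto_of_tendsto_of_le_of_le tendsto_const_nhds ?_ (fun _ => zero_le) hbd
  have h1 := ENNReal.Tendsto.mul hat (Or.inr ENNReal.zero_ne_top) hbt
    (Or.inr ENNReal.zero_ne_top)
  have h2 := ENNReal.Tendsto.const_mul hbt (a := eLpNorm a₀ 2 μ) (Or.inr ha₀.eLpNorm_ne_top)
  have h3 := ENNReal.Tendsto.mul_const hat (b := eLpNorm b₀ 2 μ) (Or.inr hb₀.eLpNorm_ne_top)
  simpa using (h1.add h2).add h3

lemma tendsto_eLpNorm_two_zero_of_dominated {X F : Type*} [MeasurableSpace X] {μ : Measure X}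
    [NormedAddCommGroup F] {f : ℕ → X → F} {h : X → F}
    (hf : ∀ k, AEStronglyMeasurable (f k) μ) (hh : MemLp h 2 μ)
    (hfh : ∀ k x, ‖f k x‖ ≤ ‖h x‖)
    (hlim : ∀ᵐ x ∂μ, Tendsto (fun k => f k x) atTop (𝓝 0)) :
    Tendsto (fun k => eLpNorm (f k) 2 μ) atTop (𝓝 0) := by
  have e : ∀ g : X → F, eLpNorm g 2 μ = (∫⁻ x, ‖g x‖ₑ ^ (2 : ℝ) ∂μ) ^ ((1 : ℝ) / 2) := fun g => by
    rw [eLpNorm_eq_lintegral_rpow_enorm_toReal (by simp) (by simp)]; simp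
  have hfin : ∫⁻ x, ‖h x‖ₑ ^ (2 : ℝ) ∂μ ≠ ⊤ := by
    simpa using (lintegral_rpow_enorm_lt_top_of_eLpNorm_lt_top (p := 2) (by simp) (by simp)
      hh.2).ne
  have key : Tendsto (fun k => ∫⁻ x, ‖f k x‖ₑ ^ (2 : ℝ) ∂μ) atTop (𝓝 (∫⁻ _, 0 ∂μ)) := by
    refine tendsto_lintegral_of_dominated_convergence' (fun x => ‖h x‖ₑ ^ (2 : ℝ))
      (fun k => (hf k).enorm.pow_const _) (fun k => Eventually.of_forall fun x => ?_) hfin ?_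
    · have := enorm_le_iff_norm_le.mpr (hfh k x)
      dsimp only
      gcongr
    · filter_upwards [hlim] with x hx
      have := (ENNReal.continuous_rpow_const (y := 2)).tendsto 0 |>.comp
        ((continuous_enorm.tendsto (0 : F)).comp hx |>.trans (by simp))
      simpa [Function.comp_def] using this
  simp only [e]
  have := (ENNReal.continuous_rpow_const (y := (1 : ℝ) / 2)).tendsto 0
  simp only [lintegral_zero] at key
  simpa [Function.comp_def] using this.comp key

end FracAllenCahn

/-! ### Closure properties of H¹₀ and the chain rule -/

namespace FracAllenCahn

variable {d : ℕ} {Ω : Set (EuclideanSpace ℝ (Fin d))}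
  {u w : EuclideanSpace ℝ (Fin d) → ℝ}
  {g h : EuclideanSpace ℝ (Fin d) → EuclideanSpace ℝ (Fin d)}

/-- The pair `(u, g)` is a limit in `L²(Ω)` of pairs `(φ, ∇φ)`, where `φ` is a test function. -/
structure IsH10Limit (Ω : Set (EuclideanSpace ℝ (Fin d))) (u : EuclideanSpace ℝ (Fin d) → ℝ)
    (g : EuclideanSpace ℝ (Fin d) → EuclideanSpace ℝ (Fin d)) : Prop where
  memLp : MemLp u 2 (volume.restrict Ω)
  memLp_grad : MemLp g 2 (volume.restrict Ω)
  approx : ∃ φ : ℕ → EuclideanSpace ℝ (Fin d) → ℝ, (∀ k, IsTestFunction Ω (φ k)) ∧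
    Tendsto (fun k => eLpNorm (φ k - u) 2 (volume.restrict Ω)) atTop (𝓝 0) ∧
    Tendsto (fun k => eLpNorm (∇ (φ k) - g) 2 (volume.restrict Ω)) atTop (𝓝 0)

lemma MemH10.isH10Limit (hu : MemH10 Ω u) : IsH10Limit Ω u (weakGrad Ω u) :=
  ⟨hu.memLp, hu.memLp_grad, hu.approx⟩

namespace IsH10Limit

lemma isWeakGradient [IsFiniteMeasure (volume.restrict Ω)] (hu : IsH10Limit Ω u g) :
    IsWeakGradient Ω u g where
  locInt := IntegrableOn.locallyIntegrableOn (hu.memLp.integrable (by norm_num))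
  locInt_grad := IntegrableOn.locallyIntegrableOn (hu.memLp_grad.integrable (by norm_num))
  byParts ψ hψ := by
    obtain ⟨φ, hφ, h1, h2⟩ := hu.approx
    have hz : ∀ {F : Type} [NormedAddCommGroup F] (f : EuclideanSpace ℝ (Fin d) → F),
        Tendsto (fun _ : ℕ => eLpNorm (f - f) 2 (volume.restrict Ω)) atTop (𝓝 0) := by
      intro F _ f
      simp
    have t1 := tendsto_integral_smul_of_tendsto_eLpNorm (fun k => (hφ k).memLp 2)
      (fun _ => hψ.memLp_gradient 2) hu.memLp (hψ.memLp_gradient 2) h1 (hz _)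
    have t2 := tendsto_integral_smul_of_tendsto_eLpNorm (fun _ => hψ.memLp 2)
      (fun k => (hφ k).memLp_gradient 2) (hψ.memLp 2) hu.memLp_grad (hz _) h2
    refine tendsto_nhds_unique t1 ?_
    simpa only [(hφ _).integral_smul_gradient hψ] using t2.neg

/-- Since `weakGrad` is an arbitrary choice, closure properties are proved for pairs with an
explicit gradient; uniqueness of weak gradients transfers them to `weakGrad`. -/
lemma weakGrad_ae_eq (hΩ : IsOpen Ω) [IsFiniteMeasure (volume.restrict Ω)]
    (hu : IsH10Limit Ω u g) : weakGrad Ω u =ᵐ[volume.restrict Ω] g := by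
  have hex : ∃ g, IsWeakGradient Ω u g := ⟨g, hu.isWeakGradient⟩
  rw [weakGrad, dif_pos hex]
  exact hex.choose_spec.ae_eq hΩ hu.isWeakGradient

lemma congr_grad (hu : IsH10Limit Ω u g) (hgh : g =ᵐ[volume.restrict Ω] h) :
    IsH10Limit Ω u h where
  memLp := hu.memLp
  memLp_grad := hu.memLp_grad.ae_eq hgh
  approx := by
    obtain ⟨φ, hφ, h1, h2⟩ := hu.approx
    refine ⟨φ, hφ, h1, ?_⟩
    simpa only [eLpNorm_congr_ae ((EventuallyEq.refl _ (∇ (φ _))).sub hgh)] using h2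

lemma memH10 (hΩ : IsOpen Ω) [IsFiniteMeasure (volume.restrict Ω)]
    (hu : IsH10Limit Ω u g) : MemH10 Ω u := by
  have h := hu.congr_grad (hu.weakGrad_ae_eq hΩ).symm
  exact { memLp := h.memLp, isWeakGradient := h.isWeakGradient, memLp_grad := h.memLp_grad,
          approx := h.approx }

lemma add (hu : IsH10Limit Ω u g) (hw : IsH10Limit Ω w h) : IsH10Limit Ω (u + w) (g + h) where
  memLp := hu.memLp.add hw.memLp
  memLp_grad := hu.memLp_grad.add hw.memLp_grad
  approx := by
    obtain ⟨φ, hφ, h1, h2⟩ := hu.approx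
    obtain ⟨ψ, hψ, h3, h4⟩ := hw.approx
    refine ⟨fun k => φ k + ψ k, fun k => (hφ k).add (hψ k), ?_, ?_⟩
    · refine tendsto_of_tendsto_of_tendsto_of_le_of_le tendsto_const_nhds
        (by simpa using h1.add h3) (fun _ => zero_le) fun k => ?_
      dsimp only
      rw [add_sub_add_comm]
      exact eLpNorm_add_le (((hφ k).memLp 2).sub hu.memLp).1 (((hψ k).memLp 2).sub hw.memLp).1
        (by norm_num)
    · refine tendsto_of_tendsto_of_tendsto_of_le_of_le tendsto_const_nhds
        (by simpa using h2.add h4) (fun _ => zero_le) fun k => ?_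
      dsimp only
      rw [(hφ k).gradient_add (hψ k), add_sub_add_comm]
      exact eLpNorm_add_le (((hφ k).memLp_gradient 2).sub hu.memLp_grad).1
        (((hψ k).memLp_gradient 2).sub hw.memLp_grad).1 (by norm_num)

/-- The chain rule in `H¹₀(Ω)`. -/
lemma comp (hu : IsH10Limit Ω u g) {G : ℝ → ℝ} (hG : ContDiff ℝ ∞ G) (hG0 : G 0 = 0)
    {C : ℝ} (hC : ∀ s, |deriv G s| ≤ C) :
    IsH10Limit Ω (fun x => G (u x)) (fun x => deriv G (u x) • g x) := by
  have hC0 : 0 ≤ C := (abs_nonneg _).trans (hC 0)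
  have hG' : Continuous (deriv G) := hG.continuous_deriv (by simp)
  have hlip : ∀ s t, ‖G s - G t‖ ≤ C * ‖s - t‖ := fun s t =>
    Convex.norm_image_sub_le_of_norm_deriv_le (s := Set.univ)
      (fun x _ => hG.differentiable (by simp) x) (fun x _ => hC x) convex_univ trivial trivial
  have hcm : ∀ {f : EuclideanSpace ℝ (Fin d) → ℝ},
      AEStronglyMeasurable f (volume.restrict Ω) →
      AEStronglyMeasurable (fun x => deriv G (f x)) (volume.restrict Ω) :=
    fun hf => hG'.comp_aestronglyMeasurable hf
  obtain ⟨φ', hφ', h1', h2'⟩ := hu.approx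
  -- A subsequence converging a.e. is needed: it gives G'(φ_k) → G'(u) a.e., which L² convergence
  -- alone does not.
  obtain ⟨ns, hns, hae⟩ := (tendstoInMeasure_of_tendsto_eLpNorm (by simp)
    (fun k => ((hφ' k).memLp 2).1) hu.memLp.1 h1').exists_seq_tendsto_ae
  obtain ⟨φ, hφ⟩ : ∃ φ, φ = fun k => φ' (ns k) := ⟨_, rfl⟩
  have hφt : ∀ k, IsTestFunction Ω (φ k) := fun k => hφ ▸ hφ' (ns k)
  have h1 : Tendsto (fun k => eLpNorm (φ k - u) 2 (volume.restrict Ω)) atTop (𝓝 0) :=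
    hφ ▸ h1'.comp hns.tendsto_atTop
  have h2 : Tendsto (fun k => eLpNorm (∇ (φ k) - g) 2 (volume.restrict Ω)) atTop (𝓝 0) :=
    hφ ▸ h2'.comp hns.tendsto_atTop
  have hae : ∀ᵐ x ∂(volume.restrict Ω), Tendsto (fun k => φ k x) atTop (𝓝 (u x)) := hφ ▸ hae
  refine ⟨?_, ?_, fun k => G ∘ φ k, fun k => (hφt k).comp hG hG0, ?_, ?_⟩
  · refine hu.memLp.of_le_mul (c := C) (hG.continuous.comp_aestronglyMeasurable hu.memLp.1)
      (Eventually.of_forall fun x => ?_)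
    simpa [hG0] using hlip (u x) 0
  · refine hu.memLp_grad.of_le_mul (c := C) ((hcm hu.memLp.1).smul hu.memLp_grad.1)
      (Eventually.of_forall fun x => ?_)
    rw [norm_smul]
    gcongr
    exact hC _
  · refine tendsto_of_tendsto_of_tendsto_of_le_of_le tendsto_const_nhds
      (by simpa using ENNReal.Tendsto.const_mul h1 (a := ENNReal.ofReal C) (by simp))
      (fun _ => zero_le) fun k => ?_
    exact eLpNorm_le_mul_eLpNorm_of_ae_le_mul (Eventually.of_forall fun x => hlip _ _) _
  -- ∇(G∘φ_k) - G'(u)g = G'(φ_k)(∇φ_k - g) + (G'(φ_k) - G'(u))g. The first term is at most C|∇φ_k -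
  -- g|; the second tends to 0 a.e. and is dominated by 2C|g|.
  · have hA : ∀ k, AEStronglyMeasurable (fun x => deriv G (φ k x) • (∇ (φ k) - g) x)
        (volume.restrict Ω) := fun k =>
      (hcm ((hφt k).memLp 2).1).smul (((hφt k).memLp_gradient 2).sub hu.memLp_grad).1
    have hB : ∀ k, AEStronglyMeasurable (fun x => (deriv G (φ k x) - deriv G (u x)) • g x)
        (volume.restrict Ω) := fun k =>
      ((hcm ((hφt k).memLp 2).1).sub (hcm hu.memLp.1)).smul hu.memLp_grad.1
    have t1 : Tendsto (fun k => eLpNorm (fun x => deriv G (φ k x) • (∇ (φ k) - g) x) 2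
        (volume.restrict Ω)) atTop (𝓝 0) := by
      refine tendsto_of_tendsto_of_tendsto_of_le_of_le tendsto_const_nhds
        (by simpa using ENNReal.Tendsto.const_mul h2 (a := ENNReal.ofReal C) (by simp))
        (fun _ => zero_le) fun k => ?_
      refine eLpNorm_le_mul_eLpNorm_of_ae_le_mul (Eventually.of_forall fun x => ?_) _
      rw [norm_smul]
      gcongr
      exact hC _
    have t2 : Tendsto (fun k => eLpNorm (fun x => (deriv G (φ k x) - deriv G (u x)) • g x) 2
        (volume.restrict Ω)) atTop (𝓝 0) := by
      refine tendsto_eLpNorm_two_zero_of_dominated hB (hu.memLp_grad.const_smul (2 * C))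
        (fun k x => ?_) ?_
      · rw [Pi.smul_apply, norm_smul, norm_smul, Real.norm_eq_abs, Real.norm_eq_abs,
          abs_of_nonneg (by positivity : 0 ≤ 2 * C)]
        gcongr
        exact (abs_sub _ _).trans (by linarith [hC (φ k x), hC (u x)])
      · filter_upwards [hae] with x hx
        have := (((hG'.tendsto (u x)).comp hx).sub_const (deriv G (u x))).smul_const (g x)
        simpa using this
    refine tendsto_of_tendsto_of_tendsto_of_le_of_le tendsto_const_nhds
      (by simpa using t1.add t2) (fun _ => zero_le) fun k => ?_
    have e : ∇ (G ∘ φ k) - (fun x => deriv G (u x) • g x) =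
        (fun x => deriv G (φ k x) • (∇ (φ k) - g) x) +
          fun x => (deriv G (φ k x) - deriv G (u x)) • g x := by
      rw [(hφt k).gradient_comp hG]
      ext1 x
      simp only [Pi.add_apply, Pi.sub_apply]
      module
    dsimp only
    rw [e]
    exact eLpNorm_add_le (hA k) (hB k) (by norm_num)

lemma const_smul (hu : IsH10Limit Ω u g) (c : ℝ) : IsH10Limit Ω (c • u) (c • g) := by
  have hd : ∀ s, deriv (fun s : ℝ => c * s) s = c := fun s => by simp
  have := hu.comp (G := fun s => c * s) (contDiff_const.mul contDiff_id) (by simp) (C := |c|)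
    (fun s => by rw [hd])
  simp only [hd] at this
  exact this

end IsH10Limit

/-! ### Sobolev embedding into L⁴ -/

lemma norm_gradient_eq_norm_fderiv (φ : EuclideanSpace ℝ (Fin d) → ℝ)
    (x : EuclideanSpace ℝ (Fin d)) : ‖∇ φ x‖ = ‖fderiv ℝ φ x‖ := by
  simp [gradient]

lemma IsTestFunction.eLpNorm_fderiv {φ : EuclideanSpace ℝ (Fin d) → ℝ} (hφ : IsTestFunction Ω φ)
    (p : ENNReal) : eLpNorm (fderiv ℝ φ) p volume = eLpNorm (∇ φ) p (volume.restrict Ω) := by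
  rw [eLpNorm_restrict_eq_of_support_subset]
  · exact eLpNorm_congr_norm_ae (Eventually.of_forall fun x => (norm_gradient_eq_norm_fderiv φ x).symm)
  · intro x hx
    by_contra h
    exact hx (hφ.gradient_eq_zero h)

/-- Fundamental theorem of calculus on the line, after the isometric identification of
`EuclideanSpace ℝ (Fin 1)` with ℝ. -/
lemma IsTestFunction.eLpNorm_top_le {Ω : Set (EuclideanSpace ℝ (Fin 1))}
    {φ : EuclideanSpace ℝ (Fin 1) → ℝ} (hφ : IsTestFunction Ω φ) :
    eLpNorm φ ⊤ (volume.restrict Ω) ≤ eLpNorm (∇ φ) 1 (volume.restrict Ω) := by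
  let e : ℝ ≃ₗᵢ[ℝ] EuclideanSpace ℝ (Fin 1) := (OrthonormalBasis.singleton (Fin 1) ℝ).repr
  have hc : ContDiff ℝ 1 (φ ∘ e) := (hφ.smooth.of_le (by simp)).comp e.contDiff
  have hs : HasCompactSupport (φ ∘ e) := hφ.compact.comp_homeomorph e.toHomeomorph
  have hd : ∀ t, ‖deriv (φ ∘ e) t‖ₑ ≤ ‖fderiv ℝ φ (e t)‖ₑ := by
    intro t
    have h1 : HasDerivAt e (e 1) t := by
      simpa using e.toContinuousLinearEquiv.toContinuousLinearMap.hasDerivAt (x := t)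
    rw [((hφ.differentiable (e t)).hasFDerivAt.comp_hasDerivAt t h1).deriv]
    refine (ContinuousLinearMap.le_opENorm _ _).trans ?_
    have : ‖e 1‖ₑ = 1 := by
      rw [e.enorm_map]; simp
    rw [this, mul_one]
  rw [eLpNorm_exponent_top]
  refine essSup_le_of_ae_le _ (Eventually.of_forall fun x => ?_)
  rw [← hφ.eLpNorm_fderiv, eLpNorm_one_eq_lintegral_enorm,
    ← e.measurePreserving.lintegral_comp_emb e.toHomeomorph.measurableEmbedding]
  calc ‖φ x‖ₑ = ‖(φ ∘ e) (e.symm x)‖ₑ := by simp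
    _ ≤ ∫⁻ t in Set.Iic (e.symm x), ‖deriv (φ ∘ e) t‖ₑ := hs.enorm_le_lintegral_Ici_deriv hc _
    _ ≤ ∫⁻ t, ‖deriv (φ ∘ e) t‖ₑ := setLIntegral_le_lintegral _ _
    _ ≤ ∫⁻ t, ‖fderiv ℝ φ (e t)‖ₑ := lintegral_mono hd

/-- A Sobolev inequality in dimension at most three. -/
lemma exists_eLpNorm_four_le_gradient (hd : 1 ≤ d) (hd3 : d ≤ 3) (hΩb : Bornology.IsBounded Ω) :
    ∃ C : ENNReal, C ≠ ⊤ ∧ ∀ φ, IsTestFunction Ω φ →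
      eLpNorm φ 4 (volume.restrict Ω) ≤ C * eLpNorm (∇ φ) 2 (volume.restrict Ω) := by
  have hV : volume.restrict Ω Set.univ ≠ ⊤ := by
    simpa using hΩb.measure_lt_top.ne
  rcases hd.eq_or_lt with rfl | hd2
  · refine ⟨volume.restrict Ω Set.univ ^ (1 / (2 : ℝ)) * volume.restrict Ω Set.univ ^ (1 / (4 : ℝ)),
      ENNReal.mul_ne_top (ENNReal.rpow_ne_top_of_nonneg (by norm_num) hV)
        (ENNReal.rpow_ne_top_of_nonneg (by norm_num) hV), fun φ hφ => ?_⟩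
    have h4 := eLpNorm_le_eLpNorm_mul_rpow_measure_univ (p := 4) le_top (hφ.memLp 4).1
    have h2 := eLpNorm_le_eLpNorm_mul_rpow_measure_univ (p := 1) (q := 2) (by norm_num)
      (hφ.memLp_gradient 2).1
    norm_num at h4 h2
    calc _ ≤ _ := h4
      _ ≤ _ := mul_le_mul_left (hφ.eLpNorm_top_le.trans h2) _
      _ = _ := by norm_num; ring
  -- The exponent p = 12/7 has Sobolev conjugate 4 in dimension 3, as 7/12 - 1/3 = 1/4, and 12/7 < 2
  -- ≤ d also covers d = 2. Hölder on the bounded set Ω then passes from L^{12/7} to L².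
  · refine ⟨eLpNormLESNormFDerivOfLeConst ℝ (volume : Measure (EuclideanSpace ℝ (Fin d))) Ω
      (12 / 7) 4 * volume.restrict Ω Set.univ ^ (1 / (12 / 7 : ℝ) - 1 / (2 : ℝ)),
      ENNReal.mul_ne_top (by simp) (ENNReal.rpow_ne_top_of_nonneg (by norm_num) hV),
      fun φ hφ => ?_⟩
    have hle : (12 / 7 : NNReal) ≤ 2 := by
      rw [← NNReal.coe_le_coe]; norm_num
    have h2 := eLpNorm_le_eLpNorm_mul_rpow_measure_univ (p := ((12 / 7 : NNReal) : ENNReal))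
      (q := 2) (by exact_mod_cast hle) (hφ.memLp_gradient 2).1
    have h4 := eLpNorm_le_eLpNorm_fderiv_of_le (p := 12 / 7) (q := 4)
      (volume : Measure (EuclideanSpace ℝ (Fin d)))
      (hφ.smooth.of_le (by simp)) ((subset_tsupport φ).trans hφ.supp)
      (by rw [← NNReal.coe_le_coe]; norm_num)
      (by
        rw [finrank_euclideanSpace_fin, ← NNReal.coe_lt_coe]
        have : (2 : ℝ) ≤ d := by exact_mod_cast hd2
        push_cast
        linarith)
      (by
        rw [finrank_euclideanSpace_fin]
        have : (3 : ℝ)⁻¹ ≤ (d : ℝ)⁻¹ :=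
          inv_anti₀ (by positivity) (by exact_mod_cast hd3)
        push_cast
        norm_num at this ⊢
        linarith) hΩb
    rw [hφ.eLpNorm_fderiv] at h4
    calc _ ≤ _ := eLpNorm_mono_measure _ Measure.restrict_le_self
      _ ≤ _ := h4
      _ ≤ _ := mul_le_mul_right h2 _
      _ = _ := by
        norm_num
        ring

/-- Fatou along an a.e. convergent subsequence of test functions, whose L⁴ norms are eventually
bounded through their gradients. -/
lemma IsH10Limit.memLp_four (hd : 1 ≤ d) (hd3 : d ≤ 3) (hΩb : Bornology.IsBounded Ω)
    (hu : IsH10Limit Ω u g) : MemLp u 4 (volume.restrict Ω) := by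
  obtain ⟨C, hC, hle⟩ := exists_eLpNorm_four_le_gradient hd hd3 hΩb
  obtain ⟨φ, hφ, h1, h2⟩ := hu.approx
  obtain ⟨ns, hns, hae⟩ := (tendstoInMeasure_of_tendsto_eLpNorm (by simp)
    (fun k => ((hφ k).memLp 2).1) hu.memLp.1 h1).exists_seq_tendsto_ae
  refine ⟨hu.memLp.1, ?_⟩
  refine (Lp.eLpNorm_lim_le_liminf_eLpNorm (fun k => ((hφ (ns k)).memLp 4).1) u hae).trans_lt ?_
  have hev : ∀ᶠ k in atTop, eLpNorm (φ (ns k)) 4 (volume.restrict Ω) ≤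
      C * (1 + eLpNorm g 2 (volume.restrict Ω)) := by
    filter_upwards [(h2.comp hns.tendsto_atTop).eventually_le_const one_pos] with k hk
    refine (hle _ (hφ _)).trans (mul_le_mul_right ?_ _)
    calc eLpNorm (∇ (φ (ns k))) 2 (volume.restrict Ω)
        = eLpNorm ((∇ (φ (ns k)) - g) + g) 2 (volume.restrict Ω) := by simp
      _ ≤ _ := eLpNorm_add_le (((hφ _).memLp_gradient 2).sub hu.memLp_grad).1 hu.memLp_grad.1
        (by norm_num)
      _ ≤ _ := add_le_add_left hk _
  refine (liminf_le_of_frequently_le' hev.frequently).trans_lt ?_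
  exact ENNReal.mul_lt_top hC.lt_top (ENNReal.add_lt_top.mpr ⟨by simp, hu.memLp_grad.2⟩)

end FracAllenCahn

namespace FracAllenCahn

/-! ### Signs of the quadrature weights -/

section Weights

lemma omega_zero (α : ℝ) : omega α 0 = 1 := by simp [omega]

lemma omega_succ (α : ℝ) (j : ℕ) : omega α (j + 1) = omega α j * ((j - α) / (j + 1)) := by
  have h1 : (j.factorial : ℝ) ≠ 0 := by exact_mod_cast j.factorial_ne_zero
  have h2 : (j : ℝ) + 1 ≠ 0 := by positivity
  simp only [omega, Finset.prod_range_succ, Nat.factorial_succ, pow_succ]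
  push_cast
  field_simp
  ring

/-- Both sign properties follow: the partial sums obey A_{n+1} = (1 - α/(n+1)) A_n, hence stay
nonnegative, and then each later weight is nonpositive. -/
lemma omega_succ_eq_sum (α : ℝ) (n : ℕ) :
    omega α (n + 1) = -(α / (n + 1)) * ∑ k ∈ Finset.range (n + 1), omega α k := by
  induction n with
  | zero => simp [omega_succ, omega_zero]
  | succ n ih =>
    have h1 : (n : ℝ) + 1 ≠ 0 := by positivity
    have h2 : (n : ℝ) + 1 + 1 ≠ 0 := by positivity
    rw [omega_succ α (n + 1), Finset.sum_range_succ, ih]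
    push_cast
    field_simp
    ring

lemma sum_omega_nonneg {α : ℝ} (hα1 : α < 1) (n : ℕ) :
    0 ≤ ∑ k ∈ Finset.range (n + 1), omega α k := by
  induction n with
  | zero => simp [omega_zero]
  | succ n ih =>
    rw [Finset.sum_range_succ, omega_succ_eq_sum]
    have : α / (n + 1) ≤ 1 := by
      rw [div_le_one (by positivity)]
      have : (0 : ℝ) ≤ n := by positivity
      linarith
    nlinarith

lemma omega_nonpos {α : ℝ} (hα0 : 0 < α) (hα1 : α < 1) {j : ℕ} (hj : j ≠ 0) :
    omega α j ≤ 0 := by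
  obtain ⟨n, rfl⟩ := Nat.exists_eq_succ_of_ne_zero hj
  rw [Nat.succ_eq_add_one, omega_succ_eq_sum, neg_mul, neg_nonpos]
  exact mul_nonneg (by positivity) (sum_omega_nonneg hα1 n)

lemma exists_fracExtrap_eq_sum {d : ℕ} {α : ℝ} (hα0 : 0 < α) (hα1 : α < 1) {n : ℕ} (hn : 1 ≤ n)
    (u : ℕ → EuclideanSpace ℝ (Fin d) → ℝ) :
    ∃ c : ℕ → ℝ, (∀ j ∈ Finset.range n, 0 ≤ c j) ∧ ∑ j ∈ Finset.range n, c j = 1 ∧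
      fracExtrap α u n = ∑ j ∈ Finset.range n, c j • u j := by
  have hsum : ∀ {M : Type} [AddCommMonoid M] (f : ℕ → M),
      ∑ j ∈ Finset.range n, f j = f 0 + ∑ j ∈ Finset.Ico 1 n, f j :=
    fun f => Finset.sum_range_eq_add_Ico f hn
  have hrefl : ∑ j ∈ Finset.Ico 1 n, omega α (n - j) = ∑ j ∈ Finset.Ico 1 n, omega α j := by
    refine Finset.sum_nbij' (fun j => n - j) (fun j => n - j) ?_ ?_ ?_ ?_ ?_ <;>
      intro j hj <;> rw [Finset.mem_Ico] at * <;> omega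
  -- Collecting terms, u_0 receives every -ω_{n-i}(-u_0); by the reflection i ↦ n - i its
  -- coefficient is the partial sum ω_0 + ⋯ + ω_{n-1}.
  obtain ⟨c, hc⟩ : ∃ c : ℕ → ℝ, c = fun j => if j = 0 then
    1 + ∑ i ∈ Finset.Ico 1 n, omega α (n - i) else -omega α (n - j) := ⟨_, rfl⟩
  have hc0 : c 0 = 1 + ∑ i ∈ Finset.Ico 1 n, omega α (n - i) := by simp [hc]
  have hcj : ∀ j ∈ Finset.Ico 1 n, c j = -omega α (n - j) := by
    intro j hj
    rw [Finset.mem_Ico] at hj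
    simp [hc, show j ≠ 0 by lia]
  refine ⟨c, ?_, ?_, ?_⟩
  · intro j hj
    rw [Finset.mem_range] at hj
    rcases Nat.eq_zero_or_pos j with rfl | hj0
    · rw [hc0, hrefl, ← omega_zero α, ← hsum]
      obtain ⟨m, rfl⟩ := Nat.exists_eq_add_of_le' hn
      exact sum_omega_nonneg hα1 m
    · rw [hcj j (Finset.mem_Ico.mpr ⟨hj0, hj⟩), neg_nonneg]
      exact omega_nonpos hα0 hα1 (by lia)
  · rw [hsum, hc0, Finset.sum_congr rfl hcj, Finset.sum_neg_distrib]
    ring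
  · have h := Finset.sum_congr (rfl : Finset.Ico 1 n = _) fun j hj => congrArg (· • u j) (hcj j hj)
    rw [hsum, hc0, h, fracExtrap, omega_zero]
    simp only [smul_sub, Finset.sum_sub_distrib, neg_smul, Finset.sum_neg_distrib, add_smul,
      Finset.sum_smul, one_smul]
    abel

lemma fracDiff_eq {d : ℕ} (α τ : ℝ) (u : ℕ → EuclideanSpace ℝ (Fin d) → ℝ) {n : ℕ}
    (hn : 1 ≤ n) : fracDiff α τ u n = τ ^ (-α) • (u n - fracExtrap α u n) := by
  rw [fracDiff, fracExtrap, ← Finset.Ico_add_one_right_eq_Icc, Finset.sum_Ico_succ_top hn,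
    Nat.sub_self, omega_zero]
  congr 1
  simp only [one_smul]
  abel

end Weights

/-! ### Energy decay for one step -/

variable {d : ℕ} {Ω : Set (EuclideanSpace ℝ (Fin d))}
  {w b : EuclideanSpace ℝ (Fin d) → ℝ}

lemma IsH10Limit.sum {ι : Type*} (s : Finset ι) (c : ι → ℝ)
    {u : ι → EuclideanSpace ℝ (Fin d) → ℝ}
    {g : ι → EuclideanSpace ℝ (Fin d) → EuclideanSpace ℝ (Fin d)}
    (h : ∀ i ∈ s, IsH10Limit Ω (u i) (g i)) :
    IsH10Limit Ω (∑ i ∈ s, c i • u i) (∑ i ∈ s, c i • g i) := by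
  classical
  induction s using Finset.induction_on with
  | empty =>
    have h0 : IsTestFunction Ω (0 : EuclideanSpace ℝ (Fin d) → ℝ) :=
      ⟨contDiff_const, HasCompactSupport.zero, by simp [tsupport]⟩
    have hg : ∇ (0 : EuclideanSpace ℝ (Fin d) → ℝ) = 0 := by
      ext1 x
      exact gradient_const x 0
    simp only [Finset.sum_empty]
    exact ⟨MemLp.zero, MemLp.zero, fun _ => 0, fun _ => h0, by simp, by simp [hg]⟩
  | insert i s hi ih =>
    rw [Finset.sum_insert hi, Finset.sum_insert hi]
    exact ((h i (Finset.mem_insert_self i s)).const_smul (c i)).add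
      (ih fun j hj => h j (Finset.mem_insert_of_mem hj))

lemma memH10_fracExtrap (hΩ : IsOpen Ω) [IsFiniteMeasure (volume.restrict Ω)] {α : ℝ}
    (hα0 : 0 < α) (hα1 : α < 1) {n : ℕ} (hn : 1 ≤ n) {u : ℕ → EuclideanSpace ℝ (Fin d) → ℝ}
    (hu : ∀ j < n, MemH10 Ω (u j)) : MemH10 Ω (fracExtrap α u n) := by
  obtain ⟨c, -, -, hc⟩ := exists_fracExtrap_eq_sum hα0 hα1 hn u
  rw [hc]
  exact (IsH10Limit.sum _ c fun j hj => (hu j (Finset.mem_range.mp hj)).isH10Limit).memH10 hΩ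

lemma abs_fracExtrap_le_one {α : ℝ} (hα0 : 0 < α) (hα1 : α < 1) {n : ℕ} (hn : 1 ≤ n)
    {u : ℕ → EuclideanSpace ℝ (Fin d) → ℝ} {x : EuclideanSpace ℝ (Fin d)}
    (hu : ∀ j < n, |u j x| ≤ 1) : |fracExtrap α u n x| ≤ 1 := by
  obtain ⟨c, hc0, hc1, hc⟩ := exists_fracExtrap_eq_sum hα0 hα1 hn u
  rw [hc, Finset.sum_apply]
  refine (Finset.abs_sum_le_sum_abs _ _).trans (hc1 ▸ Finset.sum_le_sum fun j hj => ?_)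
  rw [Pi.smul_apply, smul_eq_mul, abs_mul, abs_of_nonneg (hc0 j hj)]
  exact mul_le_of_le_one_right (hc0 j hj) (hu j (Finset.mem_range.mp hj))

lemma MemLp.integrable_mul_of_two {X : Type*} [MeasurableSpace X] {μ : Measure X} {f g : X → ℝ}
    (hf : MemLp f 2 μ) (hg : MemLp g 2 μ) : Integrable (fun x => f x * g x) μ :=
  hf.integrable_mul hg

lemma MemLp.mul_of_four {X : Type*} [MeasurableSpace X] {μ : Measure X} {f g : X → ℝ}
    (hf : MemLp f 4 μ) (hg : MemLp g 4 μ) : MemLp (fun x => f x * g x) 2 μ := by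
  have : ENNReal.HolderTriple 4 4 2 := ⟨by
    rw [← ENNReal.toReal_eq_toReal_iff' (by simp) (by simp), ENNReal.toReal_add (by simp) (by simp)]
    norm_num⟩
  exact hg.mul hf

lemma integrableOn_energyDensity [IsFiniteMeasure (volume.restrict Ω)] (κ : ℝ)
    (hw : MemH10 Ω w) (hw4 : MemLp w 4 (volume.restrict Ω)) :
    IntegrableOn (energyDensity Ω κ w) Ω := by
  have h1 : Integrable (fun x => ‖weakGrad Ω w x‖ ^ 2) (volume.restrict Ω) :=
    hw.memLp_grad.integrable_norm_pow (by norm_num)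
  have h2 : MemLp (fun x => 1 - w x * w x) 2 (volume.restrict Ω) :=
    (memLp_const 1).sub (MemLp.mul_of_four hw4 hw4)
  refine ((h1.const_mul (κ ^ 2 / 2)).add
    ((MemLp.integrable_mul_of_two h2 h2).const_mul (1 / 4))).congr
    (Eventually.of_forall fun x => ?_)
  simp only [energyDensity, potential, Pi.add_apply]
  ring

lemma memH10_sub (hΩ : IsOpen Ω) [IsFiniteMeasure (volume.restrict Ω)]
    (hw : MemH10 Ω w) (hb : MemH10 Ω b) :
    MemH10 Ω (w - b) ∧
      weakGrad Ω (w - b) =ᵐ[volume.restrict Ω] fun x => weakGrad Ω w x - weakGrad Ω b x := by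
  have h := hw.isH10Limit.add (hb.isH10Limit.const_smul (-1))
  have e1 : w + (-1 : ℝ) • b = w - b := by ext; simp; ring
  have e2 : weakGrad Ω w + (-1 : ℝ) • weakGrad Ω b =
      fun x => weakGrad Ω w x - weakGrad Ω b x := by ext1; simp; abel
  rw [e1, e2] at h
  exact ⟨h.memH10 hΩ, h.weakGrad_ae_eq hΩ⟩

/-- The energy decreases from `b` to `w` if `w` solves `D - κ² Δ w = f` and `D - f` dominates the
difference quotient of the potential. -/
lemma energyLE_of_weakEquation (hΩ : IsOpen Ω) [IsFiniteMeasure (volume.restrict Ω)] {κ : ℝ}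
    {D f : EuclideanSpace ℝ (Fin d) → ℝ} (hw : MemH10 Ω w) (hb : MemH10 Ω b)
    (hw4 : MemLp w 4 (volume.restrict Ω)) (hb4 : MemLp b 4 (volume.restrict Ω))
    (heq : WeakEquation Ω κ D w f)
    (hD : Integrable (fun x => D x * (w x - b x)) (volume.restrict Ω))
    (hf : Integrable (fun x => f x * (w x - b x)) (volume.restrict Ω))
    (hpt : ∀ᵐ x ∂(volume.restrict Ω),
      potential (w x) - potential (b x) ≤ D x * (w x - b x) - f x * (w x - b x)) :
    EnergyLE Ω κ w b := by
  have hEw := integrableOn_energyDensity κ hw hw4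
  have hEb := integrableOn_energyDensity κ hb hb4
  refine ⟨hEw, hEb, ?_⟩
  obtain ⟨hv, hvg⟩ := memH10_sub hΩ hw hb
  have hg : Integrable (fun x => (inner ℝ (weakGrad Ω w x) (weakGrad Ω (w - b) x) : ℝ))
      (volume.restrict Ω) := by
    have := (hw.memLp_grad.norm.integrable_mul hv.memLp_grad.norm)
    refine this.mono (hw.memLp_grad.1.inner hv.memLp_grad.1) (Eventually.of_forall fun x => ?_)
    simpa using abs_real_inner_le_norm (weakGrad Ω w x) (weakGrad Ω (w - b) x)
  have hκg := hg.const_mul (κ ^ 2)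
  have hDf : Integrable (fun x => D x * (w x - b x) - f x * (w x - b x)) (volume.restrict Ω) :=
    hD.sub hf
  have hq : Integrable (fun x => D x * (w x - b x) - f x * (w x - b x) + κ ^ 2 *
      inner ℝ (weakGrad Ω w x) (weakGrad Ω (w - b) x)) (volume.restrict Ω) := hDf.add hκg
  have e := heq _ hv
  simp only [Pi.sub_apply] at e
  have hle : energy Ω κ w ≤ ∫ x in Ω, (energyDensity Ω κ b x + (D x * (w x - b x)
      - f x * (w x - b x) + κ ^ 2 * inner ℝ (weakGrad Ω w x) (weakGrad Ω (w - b) x))) := by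
    refine integral_mono_ae hEw (hEb.add hq) ?_
    filter_upwards [hpt, hvg] with x hx hgx
    simp only [energyDensity, hgx]
    -- Polarization of |∇b|² = |∇w - ∇(w - b)|²; the term κ²/2|∇(w - b)|² has the favourable sign
    -- and is dropped.
    have h1 : ‖weakGrad Ω b x‖ ^ 2 = ‖weakGrad Ω w x‖ ^ 2 - 2 * inner ℝ (weakGrad Ω w x)
        (weakGrad Ω w x - weakGrad Ω b x) + ‖weakGrad Ω w x - weakGrad Ω b x‖ ^ 2 := by
      rw [← norm_sub_sq_real, sub_sub_cancel]
    have h2 := mul_nonneg (sq_nonneg κ) (sq_nonneg ‖weakGrad Ω w x - weakGrad Ω b x‖)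
    rw [h1]
    linarith
  rw [integral_add hEb hq, integral_add hDf hκg, integral_sub hD hf, integral_const_mul] at hle
  have : energy Ω κ b = ∫ x in Ω, energyDensity Ω κ b x := rfl
  linarith

lemma energyLE_wcs (hd : 1 ≤ d) (hd3 : d ≤ 3) (hΩ : IsOpen Ω) (hΩb : Bornology.IsBounded Ω)
    [IsFiniteMeasure (volume.restrict Ω)] {κ c : ℝ} (hc : 0 ≤ c)
    (hw : MemH10 Ω w) (hb : MemH10 Ω b)
    (heq : WeakEquation Ω κ (c • (w - b)) w (fun x => b x - w x ^ 3)) : EnergyLE Ω κ w b := by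
  have hw4 := hw.isH10Limit.memLp_four hd hd3 hΩb
  have hb4 := hb.isH10Limit.memLp_four hd hd3 hΩb
  have hv := hw.memLp.sub hb.memLp
  refine energyLE_of_weakEquation hΩ hw hb hw4 hb4 heq
    (MemLp.integrable_mul_of_two (hv.const_smul c) hv) ?_ (Eventually.of_forall fun x => ?_)
  -- The cubic term w³(w - b) is split as w² · w(w - b), a product of two L² functions because w and
  -- b lie in L⁴.
  · refine ((MemLp.integrable_mul_of_two hb.memLp hv).sub (MemLp.integrable_mul_of_two
      (MemLp.mul_of_four hw4 hw4) (MemLp.mul_of_four hw4 (hw4.sub hb4)))).congr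
      (Eventually.of_forall fun x => ?_)
    simp only [Pi.sub_apply]
    ring
  · simp only [potential, Pi.smul_apply, Pi.sub_apply, smul_eq_mul]
    -- The gap between the two sides is exactly c(w - b)² + (w - b)²/2 + (w² - b²)²/4 + w²(w -
    -- b)²/2.
    nlinarith [mul_nonneg hc (sq_nonneg (w x - b x)), sq_nonneg (w x ^ 2 - b x ^ 2),
      sq_nonneg (w x * (w x - b x)), sq_nonneg (w x - b x)]

/-! ### Maximum principle and energy decay for the stabilized scheme -/

/-- A smooth monotone function that vanishes exactly on `[-1, 1]`. -/
noncomputable def excess (s : ℝ) : ℝ :=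
  Real.smoothTransition (s - 1) - Real.smoothTransition (-s - 1)

lemma contDiff_excess : ContDiff ℝ ∞ excess :=
  (Real.smoothTransition.contDiff.comp (contDiff_id.sub contDiff_const)).sub
    (Real.smoothTransition.contDiff.comp (contDiff_id.neg.sub contDiff_const))

lemma monotone_excess : Monotone excess := fun s t hst =>
  sub_le_sub (Real.smoothTransition.monotone (by linarith))
    (Real.smoothTransition.monotone (by linarith))

lemma excess_of_abs_le_one {s : ℝ} (hs : |s| ≤ 1) : excess s = 0 := by
  rw [abs_le] at hs
  rw [excess, Real.smoothTransition.zero_of_nonpos (by linarith),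
    Real.smoothTransition.zero_of_nonpos (by linarith), sub_zero]

lemma excess_pos {s : ℝ} (hs : 1 < s) : 0 < excess s := by
  rw [excess, Real.smoothTransition.zero_of_nonpos (x := -s - 1) (by linarith), sub_zero]
  exact Real.smoothTransition.pos_of_pos (by linarith)

lemma excess_neg {s : ℝ} (hs : s < -1) : excess s < 0 := by
  rw [excess, Real.smoothTransition.zero_of_nonpos (x := s - 1) (by linarith), zero_sub, neg_lt_zero]
  exact Real.smoothTransition.pos_of_pos (by linarith)

/-- `excess` is constant, equal to ±1, on each side of [-2, 2], so its continuous derivative has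
compact support. The bound is what the chain rule requires. -/
lemma exists_abs_deriv_excess_le : ∃ C, ∀ s, |deriv excess s| ≤ C := by
  have hs : HasCompactSupport (deriv excess) := by
    refine HasCompactSupport.intro (isCompact_Icc (a := -2) (b := 2)) fun s hs => ?_
    rcases lt_or_ge 2 s with h2 | h2
    · have : excess =ᶠ[𝓝 s] fun _ => 1 := by
        filter_upwards [lt_mem_nhds h2] with t ht
        rw [excess, Real.smoothTransition.one_of_one_le (by linarith),
          Real.smoothTransition.zero_of_nonpos (by linarith), sub_zero]
      rw [this.deriv_eq, deriv_const]
    · have h3 : s < -2 := by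
        by_contra h
        exact hs ⟨not_lt.mp h, h2⟩
      have : excess =ᶠ[𝓝 s] fun _ => -1 := by
        filter_upwards [gt_mem_nhds h3] with t ht
        rw [excess, Real.smoothTransition.zero_of_nonpos (by linarith),
          Real.smoothTransition.one_of_one_le (by linarith), zero_sub]
      rw [this.deriv_eq, deriv_const]
  obtain ⟨C, hC⟩ := hs.exists_bound_of_continuous (contDiff_excess.continuous_deriv (by simp))
  exact ⟨C, hC⟩

/-- The maximum principle for the linear stabilized scheme. -/
lemma abs_le_one_lws (hΩ : IsOpen Ω) [IsFiniteMeasure (volume.restrict Ω)] {κ c S : ℝ}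
    (hcS : 2 ≤ S + c) (hw : MemH10 Ω w) (hb : MemH10 Ω b)
    (hb1 : ∀ᵐ x ∂(volume.restrict Ω), |b x| ≤ 1)
    (heq : WeakEquation Ω κ (c • (w - b)) w (fun x => b x - b x ^ 3 - S * (w x - b x))) :
    ∀ᵐ x ∂(volume.restrict Ω), |w x| ≤ 1 := by
  obtain ⟨C, hC⟩ := exists_abs_deriv_excess_le
  have hG := hw.isH10Limit.comp contDiff_excess (excess_of_abs_le_one (by simp)) hC
  have hGm := hG.memH10 hΩ
  have hGg := hG.weakGrad_ae_eq hΩ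
  have hv := hw.memLp.sub hb.memLp
  have hb3 : MemLp (fun x => b x ^ 3) 2 (volume.restrict Ω) :=
    MemLp.of_bound (hb.memLp.1.pow 3) 1 (by
      filter_upwards [hb1] with x hx
      rw [norm_pow]
      exact pow_le_one₀ (norm_nonneg _) hx)
  have hi1 := MemLp.integrable_mul_of_two (hv.const_smul c) hG.memLp
  have hi2 : Integrable (fun x => (b x - b x ^ 3 - S * (w x - b x)) * excess (w x))
      (volume.restrict Ω) :=
    MemLp.integrable_mul_of_two ((hb.memLp.sub hb3).sub (hv.const_mul S)) hG.memLp
  -- With the test function G(w), G = `excess`, the diffusion term is κ²∫G'(w)|∇w|² ≥ 0, so the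
  -- integral of the remaining terms is at most 0.
  have e := heq _ hGm
  have hgrad : 0 ≤ ∫ x in Ω, (inner ℝ (weakGrad Ω w x)
      (weakGrad Ω (fun x => excess (w x)) x) : ℝ) := by
    refine integral_nonneg_of_ae ?_
    filter_upwards [hGg] with x hx
    rw [hx, inner_smul_right, real_inner_self_eq_norm_sq]
    exact mul_nonneg monotone_excess.deriv_nonneg (sq_nonneg _)
  have hA : ∀ {s r : ℝ}, |r| ≤ 1 → 1 < s →
      0 < c * (s - r) - (r - r ^ 3 - S * (s - r)) := by
    intro s r hr hs
    rw [abs_le] at hr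
    -- Since S + c ≥ 2 and s > 1, the expression exceeds 2(1 - r) - r + r³ = (r + 2)(1 - r)² ≥ 0.
    nlinarith [mul_nonneg (by linarith : 0 ≤ r + 2) (sq_nonneg (1 - r)),
      mul_nonneg (sub_nonneg.mpr hcS) (by linarith : 0 ≤ s - r)]
  have hB : ∀ {s r : ℝ}, |r| ≤ 1 → s < -1 →
      c * (s - r) - (r - r ^ 3 - S * (s - r)) < 0 := by
    intro s r hr hs
    -- The expression is odd in (s, r).
    have := hA (s := -s) (r := -r) (by rwa [abs_neg]) (by linarith)
    ring_nf at this ⊢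
    linarith
  have hpos : 0 ≤ᵐ[volume.restrict Ω] fun x => (c • (w - b)) x * excess (w x) -
      (b x - b x ^ 3 - S * (w x - b x)) * excess (w x) := by
    filter_upwards [hb1] with x hx
    simp only [Pi.zero_apply, Pi.smul_apply, Pi.sub_apply, smul_eq_mul, ← sub_mul]
    by_cases h1 : |w x| ≤ 1
    · rw [excess_of_abs_le_one h1, mul_zero]
    · rw [not_le, lt_abs] at h1
      rcases h1 with h1 | h1
      · exact (mul_pos (hA hx h1) (excess_pos h1)).le
      · have h1 : w x < -1 := by linarith
        exact (mul_pos_of_neg_of_neg (hB hx h1) (excess_neg h1)).le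
  have hzero : ∫ x in Ω, ((c • (w - b)) x * excess (w x) -
      (b x - b x ^ 3 - S * (w x - b x)) * excess (w x)) = 0 := by
    refine le_antisymm ?_ (integral_nonneg_of_ae hpos)
    rw [integral_sub hi1 hi2]
    have := mul_nonneg (sq_nonneg κ) hgrad
    linarith
  -- A nonnegative integrand with zero integral vanishes a.e., yet it is strictly positive wherever
  -- |w| > 1.
  have hae := (integral_eq_zero_iff_of_nonneg_ae hpos (hi1.sub hi2)).mp hzero
  filter_upwards [hb1, hae] with x hx h0
  simp only [Pi.zero_apply, Pi.smul_apply, Pi.sub_apply, smul_eq_mul, ← sub_mul] at h0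
  by_contra h1
  rw [not_le, lt_abs] at h1
  rcases h1 with h1 | h1
  · exact (mul_pos (hA hx h1) (excess_pos h1)).ne' h0
  · have h1 : w x < -1 := by linarith
    exact (mul_pos_of_neg_of_neg (hB hx h1) (excess_neg h1)).ne' h0

/-- The bounds |w|, |b| ≤ 1 supply the L⁴ integrability directly, in place of the Sobolev embedding.
-/
lemma energyLE_lws (hΩ : IsOpen Ω) [IsFiniteMeasure (volume.restrict Ω)] {κ c S : ℝ}
    (hcS : 2 ≤ S + c) (hw : MemH10 Ω w) (hb : MemH10 Ω b)
    (hw1 : ∀ᵐ x ∂(volume.restrict Ω), |w x| ≤ 1) (hb1 : ∀ᵐ x ∂(volume.restrict Ω), |b x| ≤ 1)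
    (heq : WeakEquation Ω κ (c • (w - b)) w (fun x => b x - b x ^ 3 - S * (w x - b x))) :
    EnergyLE Ω κ w b := by
  have hv := hw.memLp.sub hb.memLp
  have hb3 : MemLp (fun x => b x ^ 3) 2 (volume.restrict Ω) :=
    MemLp.of_bound (hb.memLp.1.pow 3) 1 (by
      filter_upwards [hb1] with x hx
      rw [norm_pow]
      exact pow_le_one₀ (norm_nonneg _) hx)
  refine energyLE_of_weakEquation hΩ hw hb (MemLp.of_bound hw.memLp.1 1 hw1)
    (MemLp.of_bound hb.memLp.1 1 hb1) heq
    (MemLp.integrable_mul_of_two (hv.const_smul c) hv)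
    (MemLp.integrable_mul_of_two ((hb.memLp.sub hb3).sub (hv.const_mul S)) hv) ?_
  filter_upwards [hw1, hb1] with x hx hy
  simp only [potential, Pi.smul_apply, Pi.sub_apply, smul_eq_mul]
  generalize w x = s at *
  generalize b x = r at *
  -- F(s) - F(r) - F'(r)(s - r) = (s - r)²((s + r)² + 2r² - 2)/4 exactly; on [-1, 1] this is at most
  -- (s - r)², which (S + c)(s - r)² absorbs.
  have h1 : (s + r) ^ 2 + 2 * r ^ 2 ≤ 6 := by
    rw [abs_le] at hx hy
    nlinarith
  have h2 : 0 ≤ (s - r) ^ 2 * (S + c - ((s + r) ^ 2 + 2 * r ^ 2 - 2) / 4) :=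
    mul_nonneg (sq_nonneg _) (by linarith)
  nlinarith

end FracAllenCahn

theorem mainTheorem8 {d : ℕ} (hd : 1 ≤ d) (hd3 : d ≤ 3)
    (Ω : Set (EuclideanSpace ℝ (Fin d))) (hΩ : IsOpen Ω) (hΩb : Bornology.IsBounded Ω)
    (κ α T : ℝ) (hκ : 0 < κ) (hα0 : 0 < α) (hα1 : α < 1) (hT : 0 < T)
    (N : ℕ) (hN : 1 ≤ N) (τ : ℝ) (hτ : τ = T / N)
    (u : ℕ → EuclideanSpace ℝ (Fin d) → ℝ) :
    (∀ n, 1 ≤ n → fracExtrap α u n ∈ convexHull ℝ (u '' {j | j < n})) ∧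
    (IsWCSSolution Ω κ α τ N u →
      ∀ n, 1 ≤ n → n ≤ N → EnergyLE Ω κ (u n) (fracExtrap α u n)) ∧
    (∀ S : ℝ, 0 < S → 2 ≤ S + τ ^ (-α) → IsLWSSolution Ω κ α τ S N u →
      (∀ᵐ x ∂(volume.restrict Ω), |u 0 x| ≤ 1) →
      ∀ n, 1 ≤ n → n ≤ N → EnergyLE Ω κ (u n) (fracExtrap α u n)) := by
  have : IsFiniteMeasure (volume.restrict Ω) := ⟨by simpa using hΩb.measure_lt_top⟩
  refine ⟨fun n hn => ?_, fun hu n hn hnN => ?_, fun S _ hS hu h0 => ?_⟩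
  · obtain ⟨c, hc0, hc1, hc⟩ := exists_fracExtrap_eq_sum hα0 hα1 hn u
    rw [hc]
    exact (convex_convexHull ℝ _).sum_mem hc0 hc1 fun j hj =>
      subset_convexHull ℝ _ ⟨j, Finset.mem_range.mp hj, rfl⟩
  · have hτ0 : 0 ≤ τ := hτ ▸ by positivity
    have heq := hu.eqn n hn hnN
    rw [fracDiff_eq α τ u hn] at heq
    exact energyLE_wcs hd hd3 hΩ hΩb (Real.rpow_nonneg hτ0 _) (hu.mem n hnN)
      (memH10_fracExtrap hΩ hα0 hα1 hn fun j hj => hu.mem j (hj.le.trans hnN)) heq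
  · have heq := hu.eqn
    have hmem : ∀ n, 1 ≤ n → n ≤ N → MemH10 Ω (fracExtrap α u n) := fun n hn hnN =>
      memH10_fracExtrap hΩ hα0 hα1 hn fun j hj => hu.mem j (hj.le.trans hnN)
    have hext : ∀ n, 1 ≤ n → (∀ j < n, ∀ᵐ x ∂(volume.restrict Ω), |u j x| ≤ 1) →
        ∀ᵐ x ∂(volume.restrict Ω), |fracExtrap α u n x| ≤ 1 := by
      intro n hn h
      have : ∀ᵐ x ∂(volume.restrict Ω), ∀ j < n, |u j x| ≤ 1 :=
        ae_all_iff.mpr fun j => ae_all_iff.mpr fun hj => h j hj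
      filter_upwards [this] with x hx
      exact abs_fracExtrap_le_one hα0 hα1 hn hx
    -- Strong induction, because the extrapolation involves the whole history u_0, …, u_{n-1}.
    have hbd : ∀ n ≤ N, ∀ᵐ x ∂(volume.restrict Ω), |u n x| ≤ 1 := by
      intro n
      induction n using Nat.strong_induction_on with
      | _ n ih =>
        intro hnN
        rcases Nat.eq_zero_or_pos n with rfl | hn
        · exact h0
        · have h := heq n hn hnN
          rw [fracDiff_eq α τ u hn] at h
          exact abs_le_one_lws hΩ hS (hu.mem n hnN) (hmem n hn hnN)
            (hext n hn fun j hj => ih j hj (hj.le.trans hnN)) h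
    intro n hn hnN
    have h := heq n hn hnN
    rw [fracDiff_eq α τ u hn] at h
    exact energyLE_lws hΩ hS (hu.mem n hnN) (hmem n hn hnN) (hbd n hnN)
      (hext n hn fun j hj => hbd j (hj.le.trans hnN)) h
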